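/- Lemma 7 (Magidor). For an uncountable cardinal $\delta$ and an ordinal $\alpha$, let $P_\delta(\alpha)=\{x\subseteq\alpha : |x|<\delta\}$. Say that $\delta$ is $\alpha$-strongly compact if there is a $\delta$-complete ultrafilter $U$ over $P_\delta(\alpha)$ which is fine (that is, $\{x : \xi\in x\}\in U$ for every $\xi<\alpha$), and that $\delta$ is $\alpha$-supercompact if there is such a $U$ which is moreover normal (that is, every $f:P_\delta(\alpha)\to\alpha$ with $\{x : f(x)\in x\}\in U$ is constant on a set in $U$). A cardinal $\kappa$ is supercompact if it is uncountable and $\gamma$-supercompact for every cardinal $\gamma\ge\kappa$. Let $\kappa$ be a supercompact cardinal. Let $B$ be the set of all cardinals $\delta<\kappa$ such that the least singular strong limit cardinal $\lambda_\delta>\delta$ of cofinality $\delta$ exists and such that $\delta$ is $\lambda_\delta$-strongly compact, $\delta$ is not $\lambda_\delta$-supercompact, and $\delta$ is $\alpha$-supercompact for all $\alpha<\lambda_\delta$. Then $B$ is unbounded in $\kappa$. -/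

import Mathlib

open Cardinal Ordinal Filter

universe u

/-- `P_κ(X)`: the subsets of `X` of cardinality less than `κ`. -/
abbrev PKappa (κ : Cardinal.{u}) (X : Type u) : Type u :=
  {x : Set X // #x < κ}

/-- An ultrafilter `U` over `P_κ(X)` is fine if, for every `a ∈ X`, the set `{x | a ∈ x}`
belongs to `U`. -/
def IsFine {κ : Cardinal.{u}} {X : Type u} (U : Ultrafilter (PKappa κ X)) : Prop :=
  ∀ a : X, {x : PKappa κ X | a ∈ x.1} ∈ U

/-- An ultrafilter `U` over `P_κ(X)` is normal if every function which chooses an element of `x`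
for `U`-almost every `x` is constant on a set in `U`. -/
def IsNormalUltrafilter {κ : Cardinal.{u}} {X : Type u} (U : Ultrafilter (PKappa κ X)) : Prop :=
  ∀ f : PKappa κ X → X, {x : PKappa κ X | f x ∈ x.1} ∈ U →
    ∃ a : X, {x : PKappa κ X | f x = a} ∈ U

/-- `κ` is `α`-strongly compact: `κ` is uncountable and there is a `κ`-complete fine ultrafilter
over `P_κ(α)`. Here `α` is an ordinal, and `α.ToType` is the underlying set of `α`. -/
def IsStronglyCompactUpTo (κ : Cardinal.{u}) (α : Ordinal.{u}) : Prop :=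
  ℵ₀ < κ ∧ ∃ U : Ultrafilter (PKappa κ α.ToType),
    CardinalInterFilter (U : Filter (PKappa κ α.ToType)) κ ∧ IsFine U

/-- `κ` is `α`-supercompact: `κ` is uncountable and there is a `κ`-complete fine normal
ultrafilter over `P_κ(α)`. -/
def IsSupercompactUpTo (κ : Cardinal.{u}) (α : Ordinal.{u}) : Prop :=
  ℵ₀ < κ ∧ ∃ U : Ultrafilter (PKappa κ α.ToType),
    CardinalInterFilter (U : Filter (PKappa κ α.ToType)) κ ∧ IsFine U ∧ IsNormalUltrafilter U

/-- `κ` is supercompact if it is `γ`-supercompact for every cardinal `γ ≥ κ`. -/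
def IsSupercompact (κ : Cardinal.{u}) : Prop :=
  ∀ γ : Cardinal.{u}, κ ≤ γ → IsSupercompactUpTo κ γ.ord

/-- `γ` is the least singular strong limit cardinal above `δ` of cofinality `δ`. -/
def IsLeastSingularStrongLimit (δ γ : Cardinal.{u}) : Prop :=
  IsLeast {ν : Cardinal.{u} | δ < ν ∧ ν.IsSingular ∧ ν.IsStrongLimit ∧ ν.ord.cof = δ} γ

/-! Take the least δ > β for which λ_δ exists and δ is α-supercompact for all α < λ_δ. It is
λ_δ-strongly compact because cof λ_δ = δ (`isStronglyCompactUpTo_of_cof_eq`). It is not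
λ_δ-supercompact, since that would reflect the defining property to some δ' with β < δ' < δ
(`IsSupercompactUpTo.exists_reflection`). The same reflection, applied to κ and λ_κ, shows that such
a δ exists below κ.

Reflection replaces the ultrapower by a hand-made Łoś theorem. For U fine and normal over P_κ(X), a
statement quantifying over elements, subsets and binary relations holds of X iff it holds of
U-almost every x: by normality, any choice of s(x) ⊆ x is almost everywhere S ∩ x for a fixed S.
With |X| = λ_κ, being the least singular strong limit of the right cofinality is such a statement.
Supercompactness is of higher order, but since λ_κ is a strong limit, an ultrafilter over P_κ(A)
with |A| < λ_κ can be coded by subsets of X and relations on X. -/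

/-- A property of subsets of `X` reflects along `U` if it holds of the whole of `X` exactly when it
holds of `U`-almost every `x`. -/
def Reflects {κ : Cardinal.{u}} {X : Type u} (U : Ultrafilter (PKappa κ X))
    (P : Set X → Prop) : Prop :=
  P Set.univ ↔ ∀ᶠ x in (U : Filter (PKappa κ X)), P x.1

/-! ### Normality and reflection of second-order statements -/

section Normal

variable {κ : Cardinal.{u}} {X : Type u} {U : Ultrafilter (PKappa κ X)}

/-- Closure under diagonal intersections: a choice of counterexamples in x would be constant almost
everywhere. -/
theorem eventually_forall_mem (hn : IsNormalUltrafilter U) (Q : X → PKappa κ X → Prop)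
    (h : ∀ a, ∀ᶠ x in (U : Filter (PKappa κ X)), Q a x) :
    ∀ᶠ x in (U : Filter (PKappa κ X)), ∀ a ∈ x.1, Q a x := by
  classical
  by_contra hcon
  rw [← Ultrafilter.eventually_not] at hcon
  -- One bad point supplies a default value for `f`; `X` is not assumed nonempty.
  obtain ⟨x₀, hx₀⟩ := hcon.exists
  push Not at hx₀
  obtain ⟨a₀, -, -⟩ := hx₀
  let f : PKappa κ X → X := fun x =>
    if hx : ∃ a ∈ x.1, ¬ Q a x then hx.choose else a₀
  have hf : ∀ᶠ x in (U : Filter (PKappa κ X)), f x ∈ x.1 ∧ ¬ Q (f x) x := by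
    filter_upwards [hcon] with x hx
    push Not at hx
    have : f x = hx.choose := dif_pos hx
    rw [this]
    exact hx.choose_spec
  obtain ⟨a, ha⟩ := hn f (hf.mono fun x hx => hx.1)
  have ha : ∀ᶠ x in (U : Filter (PKappa κ X)), f x = a := ha
  obtain ⟨x, h1, h2, h3⟩ := (ha.and (hf.and (h a))).exists
  rw [h1] at h2
  exact h2.2 h3

theorem exists_eventually_eq_inter (hn : IsNormalUltrafilter U)
    (s : PKappa κ X → Set X) (hs : ∀ᶠ x in (U : Filter (PKappa κ X)), s x ⊆ x.1) :
    ∃ S : Set X, ∀ᶠ x in (U : Filter (PKappa κ X)), s x = S ∩ x.1 := by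
  refine ⟨{a | ∀ᶠ x in (U : Filter (PKappa κ X)), a ∈ s x}, ?_⟩
  have key := eventually_forall_mem hn
    (fun a x => a ∈ s x ↔ ∀ᶠ x in (U : Filter (PKappa κ X)), a ∈ s x) (fun a => by
      by_cases h : ∀ᶠ x in (U : Filter (PKappa κ X)), a ∈ s x
      · simp [h]
      · simpa [h] using Ultrafilter.eventually_not.2 h)
  filter_upwards [key, hs] with x hx hsx
  ext a
  exact ⟨fun ha => ⟨(hx a (hsx ha)).1 ha, hsx ha⟩, fun ha => (hx a ha.2).2 ha.1⟩

theorem exists_eventually_eq_inter_prod (hn : IsNormalUltrafilter U)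
    (s : PKappa κ X → Set (X × X))
    (hs : ∀ᶠ x in (U : Filter (PKappa κ X)), s x ⊆ x.1 ×ˢ x.1) :
    ∃ S : Set (X × X), ∀ᶠ x in (U : Filter (PKappa κ X)), s x = S ∩ x.1 ×ˢ x.1 := by
  refine ⟨{p | ∀ᶠ x in (U : Filter (PKappa κ X)), p ∈ s x}, ?_⟩
  have key := eventually_forall_mem hn
    (fun a x => ∀ b ∈ x.1,
      ((a, b) ∈ s x ↔ ∀ᶠ x in (U : Filter (PKappa κ X)), (a, b) ∈ s x)) (fun a =>
    eventually_forall_mem hn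
    (fun b x => (a, b) ∈ s x ↔ ∀ᶠ x in (U : Filter (PKappa κ X)), (a, b) ∈ s x) (fun b => by
      by_cases h : ∀ᶠ x in (U : Filter (PKappa κ X)), (a, b) ∈ s x
      · simp [h]
      · simpa [h] using Ultrafilter.eventually_not.2 h))
  filter_upwards [key, hs] with x hx hsx
  ext ⟨a, b⟩
  exact ⟨fun ha => ⟨(hx a (hsx ha).1 b (hsx ha).2).1 ha, hsx ha⟩,
    fun ha => (hx a ha.2.1 b ha.2.2).2 ha.1⟩

namespace Reflects

theorem const (p : Prop) : Reflects U (fun _ => p) := by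
  simp [Reflects]

theorem not {P : Set X → Prop} (h : Reflects U P) : Reflects U (fun W => ¬ P W) := by
  unfold Reflects at *
  beta_reduce
  rw [h, Ultrafilter.eventually_not]

theorem and {P Q : Set X → Prop} (hP : Reflects U P) (hQ : Reflects U Q) :
    Reflects U (fun W => P W ∧ Q W) := by
  unfold Reflects at *
  beta_reduce
  rw [hP, hQ, eventually_and]

theorem imp {P Q : Set X → Prop} (hP : Reflects U P) (hQ : Reflects U Q) :
    Reflects U (fun W => P W → Q W) := by
  unfold Reflects at *
  beta_reduce
  rw [hP, hQ, Ultrafilter.eventually_imp]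

theorem iff {P Q : Set X → Prop} (hP : Reflects U P) (hQ : Reflects U Q) :
    Reflects U (fun W => P W ↔ Q W) := by
  simp only [iff_iff_implies_and_implies]
  exact (hP.imp hQ).and (hQ.imp hP)

theorem congr {P Q : Set X → Prop} (hP : Reflects U P) (h : ∀ W, P W ↔ Q W) : Reflects U Q := by
  rwa [show Q = P from funext fun W => propext (h W).symm]

/-- By fineness, a fixed parameter may be assumed to lie in `W`. -/
theorem congr_mem (hf : IsFine U) (a : X) {P Q : Set X → Prop} (hP : Reflects U P)
    (h : ∀ W, a ∈ W → (P W ↔ Q W)) : Reflects U Q := by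
  unfold Reflects at *
  rw [← h _ (Set.mem_univ a), hP]
  refine eventually_congr ?_
  filter_upwards [hf a] with x hx using h _ hx

theorem mem (hf : IsFine U) (a : X) (A : Set X) : Reflects U (fun W => a ∈ A ∩ W) :=
  (const (a ∈ A)).congr_mem hf a fun W h => by simp [h]

theorem mem_prod (hf : IsFine U) (a b : X) (R : Set (X × X)) :
    Reflects U (fun W => (a, b) ∈ R ∩ W ×ˢ W) := by
  have : Reflects U (fun W => b ∈ {b | (a, b) ∈ R} ∩ W) := mem hf b _
  exact this.congr_mem hf a fun W h => by simp [h]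

theorem forall_mem (hf : IsFine U) (hn : IsNormalUltrafilter U) {Q : X → Set X → Prop}
    (h : ∀ a, Reflects U (Q a)) : Reflects U (fun W => ∀ a ∈ W, Q a W) := by
  unfold Reflects at *
  constructor
  · exact fun H => eventually_forall_mem hn (fun a x => Q a x.1)
      fun a => (h a).1 (H a (Set.mem_univ a))
  · intro H a _
    rw [h a]
    filter_upwards [H, hf a] with x hx hax using hx a hax

theorem exists_mem (hf : IsFine U) (hn : IsNormalUltrafilter U) {Q : X → Set X → Prop}
    (h : ∀ a, Reflects U (Q a)) : Reflects U (fun W => ∃ a ∈ W, Q a W) :=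
  (forall_mem hf hn fun a => (h a).not).not.congr fun W => by push Not; rfl

/-- Counterexamples chosen in almost every x glue, by normality, to a single S refuting the
statement for the whole of `X`. -/
theorem forall_subset (hn : IsNormalUltrafilter U) {Q : Set X → Set X → Prop}
    (h : ∀ S : Set X, Reflects U (fun W => Q (S ∩ W) W)) :
    Reflects U (fun W => ∀ S ⊆ W, Q S W) := by
  classical
  unfold Reflects at *
  constructor
  · intro H
    by_contra hcon
    rw [← Ultrafilter.eventually_not] at hcon
    let s : PKappa κ X → Set X := fun x =>
      if hx : ∃ S ⊆ x.1, ¬ Q S x.1 then hx.choose else ∅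
    have hs : ∀ᶠ x in (U : Filter (PKappa κ X)), s x ⊆ x.1 ∧ ¬ Q (s x) x.1 := by
      filter_upwards [hcon] with x hx
      push Not at hx
      have : s x = hx.choose := dif_pos hx
      rw [this]
      exact hx.choose_spec
    obtain ⟨S, hS⟩ := exists_eventually_eq_inter hn s (hs.mono fun x hx => hx.1)
    obtain ⟨x, h1, h2, h3⟩ :=
      (hS.and (hs.and ((h S).1 (H _ (Set.subset_univ _))))).exists
    rw [h1] at h2
    exact h2.2 h3
  · intro H S hS
    have := (h S).2 (H.mono fun x hx => hx _ Set.inter_subset_right)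
    beta_reduce at this
    rwa [Set.inter_univ] at this

theorem exists_subset (hn : IsNormalUltrafilter U) {Q : Set X → Set X → Prop}
    (h : ∀ S : Set X, Reflects U (fun W => Q (S ∩ W) W)) :
    Reflects U (fun W => ∃ S ⊆ W, Q S W) :=
  (forall_subset hn (Q := fun S W => ¬ Q S W) fun S => (h S).not).not.congr
    fun W => by push Not; rfl

theorem forall_rel (hn : IsNormalUltrafilter U)
    {Q : Set (X × X) → Set X → Prop}
    (h : ∀ S : Set (X × X), Reflects U (fun W => Q (S ∩ W ×ˢ W) W)) :
    Reflects U (fun W => ∀ S ⊆ W ×ˢ W, Q S W) := by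
  classical
  unfold Reflects at *
  constructor
  · intro H
    by_contra hcon
    rw [← Ultrafilter.eventually_not] at hcon
    let s : PKappa κ X → Set (X × X) := fun x =>
      if hx : ∃ S ⊆ x.1 ×ˢ x.1, ¬ Q S x.1 then hx.choose else ∅
    have hs : ∀ᶠ x in (U : Filter (PKappa κ X)), s x ⊆ x.1 ×ˢ x.1 ∧ ¬ Q (s x) x.1 := by
      filter_upwards [hcon] with x hx
      push Not at hx
      have : s x = hx.choose := dif_pos hx
      rw [this]
      exact hx.choose_spec
    obtain ⟨S, hS⟩ := exists_eventually_eq_inter_prod hn s (hs.mono fun x hx => hx.1)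
    obtain ⟨x, h1, h2, h3⟩ :=
      (hS.and (hs.and ((h S).1 (H _ (by simp))))).exists
    rw [h1] at h2
    exact h2.2 h3
  · intro H S hS
    have := (h S).2 (H.mono fun x hx => hx _ Set.inter_subset_right)
    beta_reduce at this
    rwa [Set.univ_prod_univ, Set.inter_univ] at this

theorem exists_rel (hn : IsNormalUltrafilter U)
    {Q : Set (X × X) → Set X → Prop}
    (h : ∀ S : Set (X × X), Reflects U (fun W => Q (S ∩ W ×ˢ W) W)) :
    Reflects U (fun W => ∃ S ⊆ W ×ˢ W, Q S W) :=
  (forall_rel hn (Q := fun S W => ¬ Q S W) fun S => (h S).not).not.congr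
    fun W => by push Not; rfl

theorem mk_le (hf : IsFine U) (hn : IsNormalUltrafilter U) (A B : Set X) :
    Reflects U (fun W => #(A ∩ W : Set X) ≤ #(B ∩ W : Set X)) := by
  have key : Reflects U (fun W => ∃ R ⊆ W ×ˢ W,
      (∀ a ∈ W, a ∈ A ∩ W → ∃ b ∈ W, b ∈ B ∩ W ∧ (a, b) ∈ R) ∧
      ∀ a ∈ W, ∀ a' ∈ W, ∀ b ∈ W, (a, b) ∈ R → (a', b) ∈ R → a = a') :=
    exists_rel hn fun R =>
      (forall_mem hf hn fun a => (mem hf a A).imp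
        (exists_mem hf hn fun b => (mem hf b B).and (mem_prod hf a b R))).and
      (forall_mem hf hn fun a => forall_mem hf hn fun a' => forall_mem hf hn fun b =>
        (mem_prod hf a b R).imp ((mem_prod hf a' b R).imp (const _)))
  refine key.congr fun W => ⟨?_, ?_⟩
  · rintro ⟨R, -, h1, h2⟩
    have h3 : ∀ a : (A ∩ W : Set X), ∃ b : (B ∩ W : Set X), (a.1, b.1) ∈ R := fun a => by
      obtain ⟨b, -, hb, hR⟩ := h1 a a.2.2 a.2
      exact ⟨⟨b, hb⟩, hR⟩
    choose g hg using h3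
    refine mk_le_of_injective (f := g) fun a a' e => Subtype.ext ?_
    exact h2 a a.2.2 a' a'.2.2 (g a) (g a).2.2 (hg a) (e ▸ hg a')
  · rintro ⟨i⟩
    refine ⟨{p | ∃ h : p.1 ∈ A ∩ W, (i ⟨p.1, h⟩).1 = p.2}, ?_, ?_, ?_⟩
    · rintro ⟨a, b⟩ ⟨h, e⟩
      exact ⟨h.2, e ▸ (i ⟨a, h⟩).2.2⟩
    · intro a _ ha
      exact ⟨i ⟨a, ha⟩, (i ⟨a, ha⟩).2.2, (i ⟨a, ha⟩).2, ha, rfl⟩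
    · rintro a - a' - b - ⟨h, e⟩ ⟨h', e'⟩
      have := i.injective (Subtype.ext (e.trans e'.symm))
      simpa using this

theorem mk_lt (hf : IsFine U) (hn : IsNormalUltrafilter U) (A B : Set X) :
    Reflects U (fun W => #(A ∩ W : Set X) < #(B ∩ W : Set X)) :=
  (mk_le hf hn B A).not.congr fun _ => not_le

/-- A relation whose sections at points of `C` trace out every subset of `B` expresses the
inequality without third-order quantifiers. -/
theorem two_power_mk_le (hf : IsFine U) (hn : IsNormalUltrafilter U) (B C : Set X) :
    Reflects U (fun W => 2 ^ #(B ∩ W : Set X) ≤ #(C ∩ W : Set X)) := by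
  have key : Reflects U (fun W => ∃ R ⊆ W ×ˢ W, ∀ S ⊆ W, ∃ c ∈ W, c ∈ C ∩ W ∧
      ∀ b ∈ W, b ∈ B ∩ W → ((c, b) ∈ R ↔ b ∈ S)) :=
    exists_rel hn fun R => forall_subset hn fun S => exists_mem hf hn fun c =>
      (mem hf c C).and (forall_mem hf hn fun b =>
        (mem hf b B).imp ((mem_prod hf c b R).iff (mem hf b S)))
  refine key.congr fun W => ⟨?_, ?_⟩
  · rintro ⟨R, -, h⟩
    rw [← mk_set]
    have h3 : ∀ S : Set (B ∩ W : Set X), ∃ c : (C ∩ W : Set X),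
        ∀ b : (B ∩ W : Set X), (c.1, b.1) ∈ R ↔ b ∈ S := fun S => by
      obtain ⟨c, -, hc, hR⟩ := h (Subtype.val '' S)
        ((Set.image_subset_range _ _).trans (by simp))
      exact ⟨⟨c, hc⟩, fun b => (hR b b.2.2 b.2).trans (by simp [-Set.mem_inter_iff])⟩
    choose g hg using h3
    refine mk_le_of_injective (f := g) fun S S' e => ?_
    ext b
    rw [← hg S b, e, hg S' b]
  · rw [← mk_set]
    rintro ⟨i⟩
    refine ⟨{p | ∃ S : Set (B ∩ W : Set X), (i S).1 = p.1 ∧ p.2 ∈ Subtype.val '' S}, ?_, ?_⟩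
    · rintro ⟨a, b⟩ ⟨S, rfl, b, -, rfl⟩
      exact ⟨(i S).2.2, b.2.2⟩
    · intro S hS
      refine ⟨i {b | b.1 ∈ S}, (i _).2.2, (i _).2, fun b _ hb => ⟨?_, fun hbS => ?_⟩⟩
      · rintro ⟨S', e, b', hb', rfl⟩
        have : S' = {b | b.1 ∈ S} := i.injective (Subtype.ext e)
        rw [this] at hb'
        exact hb'
      · exact ⟨_, rfl, ⟨b, hb⟩, hbS, rfl⟩

end Reflects

end Normal

/-! ### Cofinality and strong limits as second-order properties -/

/-- Covering by few small sets mentions no ordering, so it can be reflected. Initial segments give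
one direction, the infinite pigeonhole principle the other. -/
theorem cof_ord_mk_le_iff {α β : Type u} (hα : ℵ₀ ≤ #α) :
    (#α).ord.cof ≤ #β ↔ ∃ R : β → Set α, (∀ b, #(R b) < #α) ∧ ∀ a, ∃ b, a ∈ R b := by
  constructor
  · intro h
    obtain ⟨s, hs, hs'⟩ := Order.exists_cof_eq (#α).ord.ToType
    rw [Ordinal.cof_toType] at hs'
    rw [← hs'] at h
    obtain ⟨i⟩ := h
    obtain ⟨e⟩ := Cardinal.eq.1 (mk_ord_toType #α).symm
    refine ⟨fun b => {a | ∃ t : s, i t = b ∧ e a ≤ t}, fun b => ?_, fun a => ?_⟩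
    · by_cases hb : ∃ t, i t = b
      · obtain ⟨t, rfl⟩ := hb
        have : {a | ∃ t' : s, i t' = i t ∧ e a ≤ t'} ⊆ e ⁻¹' (insert t.1 (Set.Iio t.1)) := by
          rintro a ⟨t', ht', h⟩
          rw [i.injective ht'] at h
          exact h.eq_or_lt
        refine (mk_le_mk_of_subset this).trans_lt ?_
        refine (mk_preimage_of_injective _ _ e.injective).trans_lt ?_
        refine (mk_insert_le).trans_lt ?_
        have h1 : #(Set.Iio t.1) < #α := by
          have := mk_Iio_lt t.1 (by simp)
          simpa using this
        exact add_lt_of_lt hα h1 (one_lt_aleph0.trans_le hα)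
      · have : {a | ∃ t : s, i t = b ∧ e a ≤ t} = ∅ := by
          ext a
          simp only [Set.mem_ofPred_eq, Set.mem_empty_iff_false, iff_false]
          rintro ⟨t, h, -⟩
          exact hb ⟨t, h⟩
        beta_reduce
        rw [this, mk_eq_zero]
        exact aleph0_pos.trans_le hα
    · obtain ⟨t, ht, hle⟩ := hs (e a)
      exact ⟨i ⟨t, ht⟩, ⟨t, ht⟩, rfl, hle⟩
  · rintro ⟨R, hR, hcov⟩
    by_contra hlt
    choose f hf using hcov
    obtain ⟨b, hb⟩ := infinite_pigeonhole f hα (not_le.1 hlt)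
    have : f ⁻¹' {b} ⊆ R b := by
      rintro a rfl
      exact hf a
    exact ((mk_le_mk_of_subset this).trans_lt (hR b)).ne hb

namespace Reflects

variable {κ : Cardinal.{u}} {X : Type u} {U : Ultrafilter (PKappa κ X)}

theorem isStrongLimit (hf : IsFine U) (hn : IsNormalUltrafilter U) (A : Set X) :
    Reflects U (fun W => (#(A ∩ W : Set X)).IsStrongLimit) := by
  have key : Reflects U (fun W => (∃ a ∈ W, a ∈ A ∩ W) ∧ ∀ B ⊆ W, #B < #(A ∩ W : Set X) →
      ∃ C ⊆ W, #C < #(A ∩ W : Set X) ∧ 2 ^ #B ≤ #C) :=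
    (exists_mem hf hn fun a => mem hf a A).and
      (forall_subset hn fun B => (mk_lt hf hn B A).imp
        (exists_subset hn fun C => (mk_lt hf hn C A).and (two_power_mk_le hf hn B C)))
  refine key.congr fun W => ⟨?_, ?_⟩
  · rintro ⟨⟨a, -, ha⟩, h⟩
    refine ⟨mk_ne_zero_iff.2 ⟨⟨a, ha⟩⟩, fun x hx => ?_⟩
    obtain ⟨B, hB, rfl⟩ := le_mk_iff_exists_subset.1 hx.le
    obtain ⟨C, -, hC, hBC⟩ := h B (hB.trans Set.inter_subset_right) hx
    exact hBC.trans_lt hC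
  · intro h
    obtain ⟨⟨a, ha⟩⟩ := mk_ne_zero_iff.1 h.ne_zero
    refine ⟨⟨a, ha.2, ha⟩, fun B _ hBA => ?_⟩
    have h2 := h.isStrongPrelimit hBA
    obtain ⟨C, hC, hC'⟩ := le_mk_iff_exists_subset.1 h2.le
    exact ⟨C, hC.trans Set.inter_subset_right, hC' ▸ h2, hC'.ge⟩

/-- The strong limit conjunct supplies the infinitude needed for the covering criterion in each `W`.
-/
theorem isStrongLimit_and_cof_le (hf : IsFine U) (hn : IsNormalUltrafilter U) (A D : Set X) :
    Reflects U (fun W => (#(A ∩ W : Set X)).IsStrongLimit ∧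
      (#(A ∩ W : Set X)).ord.cof ≤ #(D ∩ W : Set X)) := by
  have key : Reflects U (fun W => ∃ R ⊆ W ×ˢ W,
      (∀ d ∈ W, d ∈ D ∩ W → #{a | (d, a) ∈ R} < #(A ∩ W : Set X)) ∧
      ∀ a ∈ W, a ∈ A ∩ W → ∃ d ∈ W, d ∈ D ∩ W ∧ (d, a) ∈ R) := by
    refine exists_rel hn fun R => (forall_mem hf hn fun d => (mem hf d D).imp ?_).and
      (forall_mem hf hn fun a => (mem hf a A).imp
        (exists_mem hf hn fun d => (mem hf d D).and (mem_prod hf d a R)))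
    refine (mk_lt hf hn {a | (d, a) ∈ R} A).congr_mem hf d fun W hd => ?_
    rw [show ({a | (d, a) ∈ R} ∩ W : Set X) = {a | (d, a) ∈ R ∩ W ×ˢ W} by ext; simp [hd]]
  refine ((isStrongLimit hf hn A).and key).congr fun W => and_congr_right fun hSL => ?_
  rw [cof_ord_mk_le_iff hSL.aleph0_le]
  constructor
  · rintro ⟨R, -, h1, h2⟩
    refine ⟨fun d => {a | (d.1, a.1) ∈ R}, fun d => ?_, fun a => ?_⟩
    · refine lt_of_le_of_lt ?_ (h1 d d.2.2 d.2)
      exact mk_preimage_of_injective Subtype.val {a | (d.1, a) ∈ R} Subtype.val_injective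
    · obtain ⟨d, -, hd, h⟩ := h2 a a.2.2 a.2
      exact ⟨⟨d, hd⟩, h⟩
  · rintro ⟨R, h1, h2⟩
    refine ⟨{p | ∃ (h : p.1 ∈ D ∩ W) (h' : p.2 ∈ A ∩ W), ⟨p.2, h'⟩ ∈ R ⟨p.1, h⟩}, ?_, ?_, ?_⟩
    · rintro ⟨d, a⟩ ⟨h, h', -⟩
      exact ⟨h.2, h'.2⟩
    · intro d _ hd
      refine lt_of_le_of_lt ?_ (h1 ⟨d, hd⟩)
      refine (mk_le_mk_of_subset ?_).trans (mk_image_le (f := Subtype.val))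
      rintro a ⟨h, h', h''⟩
      exact ⟨⟨a, h'⟩, h'', rfl⟩
    · intro a _ ha
      obtain ⟨d, hd⟩ := h2 ⟨a, ha⟩
      exact ⟨d, d.2.2, d.2, d.2, ha, hd⟩

theorem isStrongLimit_and_cof_eq (hf : IsFine U) (hn : IsNormalUltrafilter U) (A D : Set X) :
    Reflects U (fun W => (#(A ∩ W : Set X)).IsStrongLimit ∧
      (#(A ∩ W : Set X)).ord.cof = #(D ∩ W : Set X)) := by
  have key := (isStrongLimit_and_cof_le hf hn A D).and
    (forall_subset hn (Q := fun E W => #E < #(D ∩ W : Set X) →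
      ¬ ((#(A ∩ W : Set X)).IsStrongLimit ∧ (#(A ∩ W : Set X)).ord.cof ≤ #E)) fun E =>
        (mk_lt hf hn E D).imp (isStrongLimit_and_cof_le hf hn A E).not)
  refine key.congr fun W => ⟨?_, ?_⟩
  · rintro ⟨⟨h1, h2⟩, h3⟩
    refine ⟨h1, h2.eq_of_not_lt fun hlt => ?_⟩
    obtain ⟨E, hE, hE'⟩ := le_mk_iff_exists_subset.1 h2
    exact h3 E (hE.trans Set.inter_subset_right) (hE' ▸ hlt) ⟨h1, hE'.ge⟩
  · rintro ⟨h1, h2⟩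
    exact ⟨⟨h1, h2.le⟩, fun E _ hE h => (h.2.trans_lt hE).ne h2⟩

end Reflects

/-- Singularity is automatic from cof ν = δ < ν, so it need not be reflected. -/
theorem isLeastSingularStrongLimit_iff {δ γ : Cardinal.{u}} :
    IsLeastSingularStrongLimit δ γ ↔ (δ < γ ∧ γ.IsStrongLimit ∧ γ.ord.cof = δ) ∧
      ∀ ν : Cardinal.{u}, (δ < ν ∧ ν.IsStrongLimit ∧ ν.ord.cof = δ) → γ ≤ ν := by
  have h : {ν : Cardinal.{u} | δ < ν ∧ ν.IsSingular ∧ ν.IsStrongLimit ∧ ν.ord.cof = δ} =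
      {ν | δ < ν ∧ ν.IsStrongLimit ∧ ν.ord.cof = δ} := by
    ext ν
    refine ⟨fun ⟨h1, _, h3⟩ => ⟨h1, h3⟩, fun ⟨h1, h2, h3⟩ => ⟨h1, ⟨h2.aleph0_le, ?_⟩, h2, h3⟩⟩
    exact (h3.trans_lt h1).ne
  rw [IsLeastSingularStrongLimit, h]
  rfl

theorem Reflects.isLeastSingularStrongLimit {κ : Cardinal.{u}} {X : Type u}
    {U : Ultrafilter (PKappa κ X)} (hf : IsFine U) (hn : IsNormalUltrafilter U) (K A : Set X) :
    Reflects U (fun W =>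
      IsLeastSingularStrongLimit #(K ∩ W : Set X) #(A ∩ W : Set X)) := by
  have key := ((mk_lt hf hn K A).and (isStrongLimit_and_cof_eq hf hn A K)).and
    (forall_subset hn (Q := fun B W => (#(K ∩ W : Set X) < #B ∧ (#B).IsStrongLimit ∧
      (#B).ord.cof = #(K ∩ W : Set X)) → #(A ∩ W : Set X) ≤ #B) fun B =>
        ((mk_lt hf hn K B).and (isStrongLimit_and_cof_eq hf hn B K)).imp (mk_le hf hn A B))
  refine key.congr fun W => ?_
  rw [isLeastSingularStrongLimit_iff]
  refine and_congr_right fun _ => ⟨fun h ν hν => ?_, fun h B _ hB => h _ hB⟩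
  -- Only ν < |A ∩ W| could violate minimality, and such a ν is the size of a subset of `W`.
  by_contra hlt
  obtain ⟨B, hB, rfl⟩ := le_mk_iff_exists_subset.1 (not_le.1 hlt).le
  exact hlt (h B (hB.trans Set.inter_subset_right) hν)

/-- Pushing forward along c ↦ i⁻¹(r c) serves both to lower α and to decode coded ultrafilters. -/
theorem isSupercompactUpTo_of_map {κ : Cardinal.{u}} (hκ : ℵ₀ < κ) {α : Ordinal.{u}}
    {C A : Type u} (D : Ultrafilter C) (hD : CardinalInterFilter (D : Filter C) κ)
    (r : C → Set A) (hr : ∀ c, #(r c) < κ)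
    (hfine : ∀ a, ∀ᶠ c in (D : Filter C), a ∈ r c)
    (hnormal : ∀ f : C → A, (∀ᶠ c in (D : Filter C), f c ∈ r c) →
      ∃ a, ∀ᶠ c in (D : Filter C), f c = a)
    (hα : α.card ≤ #A) : IsSupercompactUpTo κ α := by
  rw [← mk_toType] at hα
  obtain ⟨i⟩ := hα
  let m : C → PKappa κ α.ToType := fun c =>
    ⟨i ⁻¹' r c, (mk_preimage_of_injective _ _ i.injective).trans_lt (hr c)⟩
  refine ⟨hκ, D.map m, ⟨fun S hS h => ?_⟩, fun a => hfine (i a), fun f hf => ?_⟩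
  · have : ⋂ s ∈ S, m ⁻¹' s ∈ (D : Filter C) := (cardinal_bInter_mem hS).2 h
    rw [Ultrafilter.mem_coe, Ultrafilter.mem_map, Set.preimage_sInter]
    exact this
  · have hf' : ∀ᶠ c in (D : Filter C), i (f (m c)) ∈ r c := hf
    obtain ⟨a, ha⟩ := hnormal (fun c => i (f (m c))) hf'
    obtain ⟨c, hc⟩ := ha.exists
    refine ⟨f (m c), ?_⟩
    have : ∀ᶠ c' in (D : Filter C), f (m c') = f (m c) :=
      ha.mono fun c' hc' => i.injective (hc'.trans hc.symm)
    exact this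

theorem IsSupercompactUpTo.of_card_le {κ : Cardinal.{u}} {α β : Ordinal.{u}}
    (h : IsSupercompactUpTo κ β) (hαβ : α.card ≤ β.card) : IsSupercompactUpTo κ α := by
  obtain ⟨hκ, U, hc, hf, hn⟩ := h
  exact isSupercompactUpTo_of_map hκ U hc (fun x => x.1) (fun x => x.2) hf hn
    (by rwa [mk_toType])

/-! ### Coding normal ultrafilters inside a set -/

/-- `p`, restricted to `C`, belongs to the family of subsets of `C` which is coded in `W` by the
index set `E` and the relation `Q`. -/
def CodedMem {X : Type u} (C E : Set X) (Q : Set (X × X)) (W : Set X) (p : X → Prop) : Prop :=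
  ∃ e ∈ W, e ∈ E ∧ ∀ c ∈ W, c ∈ C → (p c ↔ (e, c) ∈ Q)

/-- The family coded by `C`, `E` and `Q` is a `#K`-complete ultrafilter on `C` which is fine and
normal with respect to the subsets of `A` coded by `R`. -/
structure IsCodedNormalUltrafilter {X : Type u} (K A C : Set X) (R : Set (X × X)) (E : Set X)
    (Q : Set (X × X)) (W : Set X) : Prop where
  small : ∀ c ∈ W, c ∈ C → #{a | (c, a) ∈ R} < #K
  mono : ∀ S ⊆ W, ∀ T ⊆ W, CodedMem C E Q W (fun c => c ∈ S) →
    (∀ c ∈ W, c ∈ C → c ∈ S → c ∈ T) → CodedMem C E Q W (fun c => c ∈ T)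
  ultra : ∀ S ⊆ W, CodedMem C E Q W (fun c => c ∈ S) ↔ ¬ CodedMem C E Q W (fun c => ¬ c ∈ S)
  complete : ∀ F ⊆ W, #F < #K → (∀ f ∈ W, f ∈ F → f ∈ E) →
    CodedMem C E Q W (fun c => ∀ f ∈ W, f ∈ F → (f, c) ∈ Q)
  fine : ∀ a ∈ W, a ∈ A → CodedMem C E Q W (fun c => (c, a) ∈ R)
  normal : ∀ G ⊆ W ×ˢ W,
    CodedMem C E Q W (fun c => ∃ a ∈ W, a ∈ A ∧ (c, a) ∈ R ∧ (c, a) ∈ G) →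
      ∃ a ∈ W, a ∈ A ∧ CodedMem C E Q W (fun c => (c, a) ∈ G)

/-- A coded version of supercompactness inside `W`. -/
def CodedSupercompact {X : Type u} (K A W : Set X) : Prop :=
  ∃ C ⊆ W, ∃ R ⊆ W ×ˢ W, ∃ E ⊆ W, ∃ Q ⊆ W ×ˢ W, IsCodedNormalUltrafilter K A C R E Q W

section Reflection

variable {κ : Cardinal.{u}} {X : Type u} {U : Ultrafilter (PKappa κ X)}

theorem Reflects.codedMem (hf : IsFine U) (hn : IsNormalUltrafilter U) (C E : Set X)
    (Q : Set (X × X)) {p : Set X → X → Prop} (hp : ∀ c, Reflects U (fun W => p W c)) :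
    Reflects U (fun W => CodedMem (C ∩ W) (E ∩ W) (Q ∩ W ×ˢ W) W (p W)) :=
  exists_mem hf hn fun e => (mem hf e E).and (forall_mem hf hn fun c =>
    (mem hf c C).imp ((hp c).iff (mem_prod hf e c Q)))

theorem Reflects.isCodedNormalUltrafilter (hf : IsFine U) (hn : IsNormalUltrafilter U)
    (K A C : Set X) (R : Set (X × X)) (E : Set X) (Q : Set (X × X)) :
    Reflects U (fun W => IsCodedNormalUltrafilter (K ∩ W) (A ∩ W) (C ∩ W) (R ∩ W ×ˢ W)
      (E ∩ W) (Q ∩ W ×ˢ W) W) := by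
  have h1 : Reflects U (fun W => ∀ c ∈ W, c ∈ C ∩ W →
      #{a | (c, a) ∈ R ∩ W ×ˢ W} < #(K ∩ W : Set X)) := by
    refine forall_mem hf hn fun c => (mem hf c C).imp ?_
    refine (mk_lt hf hn {a | (c, a) ∈ R} K).congr_mem hf c fun W hc => ?_
    rw [show ({a | (c, a) ∈ R} ∩ W : Set X) = {a | (c, a) ∈ R ∩ W ×ˢ W} by ext; simp [hc]]
  have h2 : Reflects U (fun W => ∀ S ⊆ W, ∀ T ⊆ W,
      CodedMem (C ∩ W) (E ∩ W) (Q ∩ W ×ˢ W) W (fun c => c ∈ S) →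
      (∀ c ∈ W, c ∈ C ∩ W → c ∈ S → c ∈ T) →
      CodedMem (C ∩ W) (E ∩ W) (Q ∩ W ×ˢ W) W (fun c => c ∈ T)) :=
    forall_subset hn fun S => forall_subset hn fun T =>
      (codedMem hf hn C E Q (p := fun W c => c ∈ S ∩ W) fun c => mem hf c S).imp
      ((forall_mem hf hn fun c => (mem hf c C).imp ((mem hf c S).imp (mem hf c T))).imp
      (codedMem hf hn C E Q (p := fun W c => c ∈ T ∩ W) fun c => mem hf c T))
  have h3 : Reflects U (fun W => ∀ S ⊆ W,
      CodedMem (C ∩ W) (E ∩ W) (Q ∩ W ×ˢ W) W (fun c => c ∈ S) ↔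
      ¬ CodedMem (C ∩ W) (E ∩ W) (Q ∩ W ×ˢ W) W (fun c => ¬ c ∈ S)) :=
    forall_subset hn fun S =>
      (codedMem hf hn C E Q (p := fun W c => c ∈ S ∩ W) fun c => mem hf c S).iff
      (codedMem hf hn C E Q (p := fun W c => ¬ c ∈ S ∩ W) fun c => (mem hf c S).not).not
  have h4 : Reflects U (fun W => ∀ F ⊆ W, #F < #(K ∩ W : Set X) →
      (∀ f ∈ W, f ∈ F → f ∈ E ∩ W) →
      CodedMem (C ∩ W) (E ∩ W) (Q ∩ W ×ˢ W) W
        (fun c => ∀ f ∈ W, f ∈ F → (f, c) ∈ Q ∩ W ×ˢ W)) :=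
    forall_subset hn fun F => (mk_lt hf hn F K).imp
      ((forall_mem hf hn fun f => (mem hf f F).imp (mem hf f E)).imp
      (codedMem hf hn C E Q
        (p := fun W c => ∀ f ∈ W, f ∈ F ∩ W → (f, c) ∈ Q ∩ W ×ˢ W) fun c =>
        forall_mem hf hn fun f => (mem hf f F).imp (mem_prod hf f c Q)))
  have h5 : Reflects U (fun W => ∀ a ∈ W, a ∈ A ∩ W →
      CodedMem (C ∩ W) (E ∩ W) (Q ∩ W ×ˢ W) W (fun c => (c, a) ∈ R ∩ W ×ˢ W)) :=
    forall_mem hf hn fun a => (mem hf a A).imp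
      (codedMem hf hn C E Q (p := fun W c => (c, a) ∈ R ∩ W ×ˢ W) fun c => mem_prod hf c a R)
  have h6 : Reflects U (fun W => ∀ G ⊆ W ×ˢ W,
      CodedMem (C ∩ W) (E ∩ W) (Q ∩ W ×ˢ W) W
        (fun c => ∃ a ∈ W, a ∈ A ∩ W ∧ (c, a) ∈ R ∩ W ×ˢ W ∧ (c, a) ∈ G) →
      ∃ a ∈ W, a ∈ A ∩ W ∧
        CodedMem (C ∩ W) (E ∩ W) (Q ∩ W ×ˢ W) W (fun c => (c, a) ∈ G)) :=
    forall_rel hn fun G =>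
      (codedMem hf hn C E Q (p := fun W c => ∃ a ∈ W, a ∈ A ∩ W ∧ (c, a) ∈ R ∩ W ×ˢ W ∧
        (c, a) ∈ G ∩ W ×ˢ W) fun c => exists_mem hf hn fun a => (mem hf a A).and
          ((mem_prod hf c a R).and (mem_prod hf c a G))).imp
      (exists_mem hf hn fun a => (mem hf a A).and
        (codedMem hf hn C E Q (p := fun W c => (c, a) ∈ G ∩ W ×ˢ W) fun c => mem_prod hf c a G))
  exact (h1.and (h2.and (h3.and (h4.and (h5.and h6))))).congr fun W =>
    ⟨fun ⟨h1, h2, h3, h4, h5, h6⟩ => ⟨h1, h2, h3, h4, h5, h6⟩,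
      fun ⟨h1, h2, h3, h4, h5, h6⟩ => ⟨h1, h2, h3, h4, h5, h6⟩⟩

theorem Reflects.codedSupercompact (hf : IsFine U) (hn : IsNormalUltrafilter U) (K A : Set X) :
    Reflects U (fun W => CodedSupercompact (K ∩ W) (A ∩ W) W) :=
  exists_subset hn fun C => exists_rel hn fun R => exists_subset hn fun E =>
    exists_rel hn fun Q => isCodedNormalUltrafilter hf hn K A C R E Q

end Reflection

theorem CodedSupercompact.isSupercompactUpTo {X : Type u} {K A W : Set X} (hA : A ⊆ W)
    (h : CodedSupercompact K A W) (hK : ℵ₀ < #K) : IsSupercompactUpTo #K (#A).ord := by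
  obtain ⟨C, hC, R, -, E, hE, Q, -, H⟩ := h
  have congr : ∀ {p q : X → Prop}, (∀ c ∈ C, p c ↔ q c) →
      CodedMem C E Q W p → CodedMem C E Q W q := fun hpq ⟨e, h1, h2, h3⟩ =>
    ⟨e, h1, h2, fun c hcW hc => (hpq c hc).symm.trans (h3 c hcW hc)⟩
  let M : Set C → Prop := fun s => CodedMem C E Q W (fun c => c ∈ Subtype.val '' s)
  have hsub : ∀ s : Set C, Subtype.val '' s ⊆ W := fun s => by
    rintro _ ⟨c, -, rfl⟩
    exact hC c.2
  have hM : ∀ (p : X → Prop), M {c | p c} ↔ CodedMem C E Q W p := fun p =>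
    ⟨congr fun c hc => by simp [hc], congr fun c hc => by simp [hc]⟩
  have hmono : ∀ s t : Set C, M s → s ⊆ t → M t := fun s t hs hst =>
    H.mono _ (hsub s) _ (hsub t) hs fun c _ _ hc => Set.image_mono hst hc
  have hcompl : ∀ s : Set C, M s ↔ ¬ M sᶜ := fun s => by
    refine (H.ultra _ (hsub s)).trans (not_congr ?_)
    exact ⟨congr fun c hc => by simp [hc], congr fun c hc => by simp [hc]⟩
  have hinter : ∀ S : Set (Set C), #S < #K → (∀ s ∈ S, M s) → M (⋂₀ S) := fun S hS h => by
    -- Choosing one index per member of `S` keeps the index set smaller than `K`, as coded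
    -- completeness requires.
    choose e heW heE he using fun s : S => h s.1 s.2
    have := H.complete (Set.range e) (by rintro _ ⟨s, rfl⟩; exact heW s)
      (mk_range_le.trans_lt hS) (by rintro _ - ⟨s, rfl⟩; exact heE s)
    refine congr (fun c hc => ⟨fun h1 => ?_, ?_⟩) this
    · refine ⟨⟨c, hc⟩, fun s hs => ?_, rfl⟩
      obtain ⟨c', hc', rfl⟩ := (he ⟨s, hs⟩ c (hC hc) hc).2 (h1 _ (heW _) ⟨_, rfl⟩)
      exact hc'
    · rintro ⟨c', h1, rfl⟩ _ - ⟨s, rfl⟩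
      exact (he s c' (hC hc) hc).1 ⟨c', h1 s s.2, rfl⟩
  let F : Filter C :=
    { sets := {s | M s}
      univ_sets := by
        have := hinter ∅ (by simpa using aleph0_pos.trans hK) (by simp)
        simpa using this
      sets_of_superset := fun hs hst => hmono _ _ hs hst
      inter_sets := fun {s t} hs ht => by
        have := hinter {s, t} (lt_of_lt_of_le (lt_aleph0_of_finite _) hK.le) (by
          rintro _ (rfl | rfl)
          exacts [hs, ht])
        rwa [Set.sInter_pair] at this }
  let D : Ultrafilter C := Ultrafilter.ofComplNotMemIff F fun s => (hcompl s).symm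
  have hD : ∀ s, s ∈ (D : Filter C) ↔ M s := fun s => Iff.rfl
  refine isSupercompactUpTo_of_map hK (A := A) D ⟨fun S hS h => hinter S hS h⟩
    (fun c => {a | (c.1, a.1) ∈ R}) (fun c => ?_) (fun a => ?_) (fun f hf => ?_) (by simp)
  · refine lt_of_le_of_lt ?_ (H.small c (hC c.2) c.2)
    exact mk_preimage_of_injective Subtype.val {a | (c.1, a) ∈ R} Subtype.val_injective
  · exact (hM _).2 (H.fine a (hA a.2) a.2)
  · let G : Set (X × X) := {p | ∃ h : p.1 ∈ C, (f ⟨p.1, h⟩).1 = p.2}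
    obtain ⟨a, haW, haA, ha⟩ := H.normal G (by
      rintro ⟨c, a⟩ ⟨h, e⟩
      exact ⟨hC h, e ▸ hA (f ⟨c, h⟩).2⟩) ((hM _).1 (hmono _ _ hf fun c hc =>
        ⟨f c, hA (f c).2, (f c).2, hc, c.2, rfl⟩))
    refine ⟨⟨a, haA⟩, hmono _ _ ((hM _).2 ha) ?_⟩
    rintro c ⟨h, e⟩
    exact Subtype.ext e

/-- The size bound on `X` lets both P_K(A) and its power set embed in `X`, as points and as indices.
-/
theorem IsSupercompactUpTo.codedSupercompact {X : Type u} {K A : Set X}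
    (h : IsSupercompactUpTo #K (#A).ord) (hA : 2 ^ (2 ^ #A : Cardinal.{u}) ≤ #X) :
    CodedSupercompact K A Set.univ := by
  obtain ⟨hK, U, hc, hf, hn⟩ := h
  obtain ⟨j⟩ : Nonempty (A ≃ (#A).ord.ToType) := Cardinal.eq.1 (by simp)
  have hP : #(PKappa #K (#A).ord.ToType) ≤ 2 ^ #A := by
    refine (mk_subtype_le _).trans ?_
    simp
  obtain ⟨eC⟩ : Nonempty (PKappa #K (#A).ord.ToType ↪ X) :=
    (hP.trans ((cantor _).le.trans hA))
  obtain ⟨eE⟩ : Nonempty (Set (PKappa #K (#A).ord.ToType) ↪ X) := by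
    refine le_def _ _ |>.1 (le_trans ?_ hA)
    rw [mk_set]
    exact power_le_power_left two_ne_zero hP
  let R : Set (X × X) := {p | ∃ y, eC y = p.1 ∧ ∃ a : A, a.1 = p.2 ∧ j a ∈ y.1}
  let Q : Set (X × X) := {p | ∃ s y, eE s = p.1 ∧ eC y = p.2 ∧ y ∈ s}
  have hR : ∀ y a, (eC y, a) ∈ R ↔ ∃ h : a ∈ A, j ⟨a, h⟩ ∈ y.1 := fun y a => by
    constructor
    · rintro ⟨y', hy', a, rfl, h⟩
      rw [eC.injective hy'] at h
      exact ⟨a.2, h⟩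
    · rintro ⟨h, h'⟩
      exact ⟨y, rfl, ⟨a, h⟩, rfl, h'⟩
  have hQ : ∀ s y, (eE s, eC y) ∈ Q ↔ y ∈ s := fun s y => by
    constructor
    · rintro ⟨s', y', hs, hy, h⟩
      rwa [eE.injective hs, eC.injective hy] at h
    · exact fun h => ⟨s, y, rfl, rfl, h⟩
  have hmem : ∀ p : X → Prop, CodedMem (Set.range eC) (eE '' {s | s ∈ U}) Q Set.univ p ↔
      ∀ᶠ y in (U : Filter _), p (eC y) := fun p => by
    constructor
    · rintro ⟨_, -, ⟨s, hs, rfl⟩, h⟩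
      filter_upwards [hs] with y hy
      exact (h _ trivial ⟨y, rfl⟩).2 ((hQ s y).2 hy)
    · intro h
      refine ⟨eE {y | p (eC y)}, trivial, ⟨_, h, rfl⟩, ?_⟩
      rintro _ - ⟨y, rfl⟩
      rw [hQ]
      rfl
  refine ⟨Set.range eC, Set.subset_univ _, R, by simp, eE '' {s | s ∈ U}, Set.subset_univ _, Q,
    by simp, ⟨?_, ?_, ?_, ?_, ?_, ?_⟩⟩
  · rintro _ - ⟨y, rfl⟩
    refine lt_of_le_of_lt ?_ y.2
    have : {a | (eC y, a) ∈ R} ⊆ Subtype.val '' (j ⁻¹' y.1) := by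
      intro a ha
      obtain ⟨h, h'⟩ := (hR y a).1 ha
      exact ⟨⟨a, h⟩, h', rfl⟩
    exact ((mk_le_mk_of_subset this).trans mk_image_le).trans
      (mk_preimage_of_injective _ _ j.injective)
  · intro S _ T _ hS hST
    rw [hmem] at hS ⊢
    exact hS.mono fun y hy => hST _ trivial ⟨y, rfl⟩ hy
  · intro S _
    rw [hmem, hmem, Ultrafilter.eventually_not, not_not]
  · intro F _ hF hFE
    rw [hmem]
    have : ∀ᶠ y in (U : Filter _), ∀ f : F, (f.1, eC y) ∈ Q := by
      refine (eventually_cardinal_forall hF).2 fun f => ?_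
      obtain ⟨s, hs, h⟩ := hFE f trivial f.2
      filter_upwards [hs] with y hy
      rw [← h, hQ]
      exact hy
    exact this.mono fun y hy f _ hf => hy ⟨f, hf⟩
  · intro a _ ha
    rw [hmem]
    filter_upwards [hf (j ⟨a, ha⟩)] with y hy
    exact (hR y a).2 ⟨ha, hy⟩
  · intro G _ hG
    rw [hmem] at hG
    -- `a₀` is the default value that makes `g` total.
    obtain ⟨y₀, a₀, -, ha₀, -⟩ := hG.exists
    have : ∀ y, ∃ a : A, (∃ a ∈ Set.univ, a ∈ A ∧ (eC y, a) ∈ R ∧ (eC y, a) ∈ G) →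
        (eC y, a.1) ∈ R ∧ (eC y, a.1) ∈ G := fun y => by
      by_cases h : ∃ a ∈ Set.univ, a ∈ A ∧ (eC y, a) ∈ R ∧ (eC y, a) ∈ G
      · obtain ⟨a, -, ha, h'⟩ := h
        exact ⟨⟨a, ha⟩, fun _ => h'⟩
      · exact ⟨⟨a₀, ha₀⟩, fun h' => (h h').elim⟩
    choose g hg using this
    obtain ⟨b, hb⟩ := hn (fun y => j (g y)) (by
      filter_upwards [hG] with y hy
      obtain ⟨_, h'⟩ := (hR y _).1 (hg y hy).1
      exact h')
    refine ⟨j.symm b, trivial, (j.symm b).2, ?_⟩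
    rw [hmem]
    filter_upwards [hG, hb] with y hy hby
    have hby : j (g y) = b := hby
    rw [← hby, j.symm_apply_apply]
    exact (hg y hy).2

/-! ### Reflection below a supercompact cardinal -/

theorem eventually_subset {κ : Cardinal.{u}} {X : Type u} {U : Ultrafilter (PKappa κ X)}
    (hc : CardinalInterFilter (U : Filter (PKappa κ X)) κ) (hf : IsFine U) {Z : Set X}
    (hZ : #Z < κ) : ∀ᶠ x in (U : Filter (PKappa κ X)), Z ⊆ x.1 := by
  have : ∀ᶠ x in (U : Filter (PKappa κ X)), ∀ z : Z, z.1 ∈ x.1 :=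
    (eventually_cardinal_forall hZ).2 fun z => hf z.1
  exact this.mono fun x hx z hz => hx ⟨z, hz⟩

/-- Otherwise fewer than κ sets of size below κ cover κ. By completeness and fineness some x
contains them all, contradicting |x| < κ. -/
theorem IsSupercompactUpTo.cof_ord {κ : Cardinal.{u}} (h : IsSupercompactUpTo κ κ.ord) :
    κ.ord.cof = κ := by
  obtain ⟨hκ, U, hc, hf, -⟩ := h
  refine (cof_ord_le κ).eq_of_not_lt fun hlt => ?_
  have hα : #κ.ord.ToType = κ := mk_ord_toType κ
  obtain ⟨R, hR, hcov⟩ := (cof_ord_mk_le_iff (α := κ.ord.ToType) (β := κ.ord.cof.out)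
    (by rw [hα]; exact hκ.le)).1 (by rw [hα, mk_out])
  have : ∀ᶠ x in (U : Filter (PKappa κ κ.ord.ToType)), ∀ b, R b ⊆ x.1 :=
    (eventually_cardinal_forall (by rwa [mk_out])).2
      fun b => eventually_subset hc hf ((hR b).trans_eq hα)
  obtain ⟨x, hx⟩ := this.exists
  have huniv : x.1 = Set.univ := Set.eq_univ_of_forall fun a => by
    obtain ⟨b, hb⟩ := hcov a
    exact hx b hb
  have := x.2
  rw [huniv, mk_univ, hα] at this
  exact this.false

theorem exists_isLeastSingularStrongLimit {κ : Cardinal.{u}} (hκ : ℵ₀ ≤ κ)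
    (hreg : κ.ord.cof = κ) : ∃ γ, IsLeastSingularStrongLimit κ γ := by
  suffices h : {ν : Cardinal.{u} | κ < ν ∧ ν.IsSingular ∧ ν.IsStrongLimit ∧
      ν.ord.cof = κ}.Nonempty from ⟨sInf _, csInf_mem h, fun _ => csInf_le'⟩
  have hlim : Order.IsSuccLimit κ.ord := isSuccLimit_ord hκ
  have hne : κ.ord ≠ 0 := by simpa using (aleph0_pos.trans_le hκ).ne'
  have hlim2 : Order.IsSuccLimit (κ.ord + κ.ord) := isSuccLimit_add _ hlim
  -- The index κ + κ is a limit of cofinality κ, and it exceeds κ, which puts its beth number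
  -- strictly above κ.
  have hcof : (ℶ_ (κ.ord + κ.ord)).ord.cof = κ := by
    have := cof_map_of_isNormal (isNormal_ord.comp isNormal_beth) hlim2
    rw [Function.comp_apply] at this
    rw [this, cof_add _ hne, hreg]
  have hlt : κ < ℶ_ (κ.ord + κ.ord) :=
    (le_beth_ord κ).trans_lt (beth_lt_beth.2 (by simpa using pos_iff_ne_zero.2 hne))
  exact ⟨_, hlt, ⟨aleph0_le_beth _, (hcof.trans_lt hlt).ne⟩,
    isStrongLimit_beth.2 hlim2.isSuccPrelimit, hcof⟩

theorem exists_reflection_of_isNormalUltrafilter {κ : Cardinal.{u}} {X : Type u}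
    {U : Ultrafilter (PKappa κ X)} (hκ : ℵ₀ < κ)
    (hc : CardinalInterFilter (U : Filter (PKappa κ X)) κ) (hf : IsFine U)
    (hn : IsNormalUltrafilter U) (hX : IsLeastSingularStrongLimit κ #X)
    (hSC : ∀ α < (#X).ord, IsSupercompactUpTo κ α) {β : Ordinal.{u}} (hβ : β < κ.ord) :
    ∃ δ < κ, β < δ.ord ∧ ∃ γ, IsLeastSingularStrongLimit δ γ ∧
      ∀ α < γ.ord, IsSupercompactUpTo δ α := by
  have hlt : κ < #X := hX.1.1
  have hSL : (#X).IsStrongLimit := hX.1.2.2.1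
  obtain ⟨K, hK⟩ := le_mk_iff_exists_set.1 hlt.le
  -- Almost every x contains `Z` and satisfies |Z| < |K ∩ x|, so δ = |K ∩ x| is uncountable and
  -- above β.
  obtain ⟨Z, hZ⟩ := le_mk_iff_exists_set.1
    (max_le (hκ.le.trans hlt.le) ((lt_ord.1 hβ).le.trans hlt.le) : max ℵ₀ β.card ≤ #X)
  have hZκ : #Z < κ := hZ ▸ max_lt hκ (lt_ord.1 hβ)
  have h1 := (Reflects.isLeastSingularStrongLimit hf hn K Set.univ).1 (by simpa [hK] using hX)
  -- Subsets `B` smaller than `X` stand for the ordinals α < λ; two uses of the strong limit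
  -- property give room for the codes.
  have h2 : ∀ᶠ x in (U : Filter (PKappa κ X)), ∀ B : Set X, B ⊆ x.1 → #B < #(Set.univ ∩ x.1 : Set X) →
      CodedSupercompact (K ∩ x.1) B x.1 := by
    refine (Reflects.forall_subset hn (Q := fun B W => #B < #(Set.univ ∩ W : Set X) →
      CodedSupercompact (K ∩ W) B W) fun B => (Reflects.mk_lt hf hn B Set.univ).imp
        (Reflects.codedSupercompact hf hn K B)).1 fun B _ hB => ?_
    have hB' : #B < #X := by simpa using hB
    rw [Set.inter_univ]
    refine IsSupercompactUpTo.codedSupercompact ?_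
      (hSL.isStrongPrelimit (hSL.isStrongPrelimit hB')).le
    rw [hK]
    exact hSC _ (ord_lt_ord.2 hB')
  have h3 := (Reflects.mk_lt hf hn Z K).1 (by simpa [hK] using hZκ)
  obtain ⟨x, ⟨h1, h2⟩, h3, h4⟩ := ((h1.and h2).and (h3.and (eventually_subset hc hf hZκ))).exists
  rw [Set.inter_eq_left.2 h4, hZ] at h3
  have hδ := (le_max_left _ _).trans_lt h3
  refine ⟨#(K ∩ x.1 : Set X), (mk_le_mk_of_subset Set.inter_subset_right).trans_lt x.2,
    lt_ord.2 ((le_max_right _ _).trans_lt h3), _, h1, fun α hα => ?_⟩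
  obtain ⟨B, hB, hBα⟩ := le_mk_iff_exists_subset.1 (lt_ord.1 hα).le
  have hBx : B ⊆ x.1 := hB.trans Set.inter_subset_right
  refine ((h2 B hBx (hBα ▸ lt_ord.1 hα)).isSupercompactUpTo hBx hδ).of_card_le ?_
  rw [card_ord, hBα]

theorem IsSupercompactUpTo.exists_reflection {κ γ : Cardinal.{u}}
    (hγ : IsLeastSingularStrongLimit κ γ) (h : IsSupercompactUpTo κ γ.ord) {β : Ordinal.{u}}
    (hβ : β < κ.ord) :
    ∃ δ < κ, β < δ.ord ∧ ∃ γ', IsLeastSingularStrongLimit δ γ' ∧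
      ∀ α < γ'.ord, IsSupercompactUpTo δ α := by
  have hSC : ∀ α < γ.ord, IsSupercompactUpTo κ α := fun α hα =>
    h.of_card_le (card_le_card hα.le)
  obtain ⟨hκ, U, hc, hf, hn⟩ := h
  exact exists_reflection_of_isNormalUltrafilter hκ hc hf hn (by rwa [mk_ord_toType])
    (by rwa [mk_ord_toType]) hβ

/-! ### Strong compactness and the conclusion -/

/-- If `δ` is `α`-supercompact for all `α` below a cardinal `γ` of cofinality `δ`, then it is
`γ`-strongly compact: integrate fine ultrafilters on `P_δ(α)`, for `α` in a cofinal subset of `γ`,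
along a fine ultrafilter on `P_δ(δ)`. -/
theorem isStronglyCompactUpTo_of_cof_eq {δ γ : Cardinal.{u}} (hlt : δ < γ)
    (hcof : γ.ord.cof = δ) (h : ∀ α < γ.ord, IsSupercompactUpTo δ α) :
    IsStronglyCompactUpTo δ γ.ord := by
  obtain ⟨hδ, V, hVc, hVf, -⟩ := h δ.ord (ord_lt_ord.2 hlt)
  obtain ⟨s, hs, hsδ⟩ := Order.exists_cof_eq γ.ord.ToType
  rw [cof_toType, hcof] at hsδ
  obtain ⟨e⟩ : Nonempty (s ≃ δ.ord.ToType) := Cardinal.eq.1 (by simp [hsδ])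
  have hD : ∀ b : γ.ord.ToType, ∃ D : Ultrafilter (PKappa δ γ.ord.ToType),
      CardinalInterFilter (D : Filter (PKappa δ γ.ord.ToType)) δ ∧
      ∀ a < b, {x : PKappa δ γ.ord.ToType | a ∈ x.1} ∈ D := by
    intro b
    have hb : #(Set.Iio b) < γ := by
      have := mk_Iio_lt b (by simp)
      simpa using this
    obtain ⟨-, D, hDc, hDf, -⟩ := h (#(Set.Iio b)).ord (ord_lt_ord.2 hb)
    obtain ⟨j⟩ : Nonempty (Set.Iio b ≃ (#(Set.Iio b)).ord.ToType) := Cardinal.eq.1 (by simp)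
    let m : PKappa δ (#(Set.Iio b)).ord.ToType → PKappa δ γ.ord.ToType := fun x =>
      ⟨Subtype.val '' (j ⁻¹' x.1), (mk_image_le.trans
        (mk_preimage_of_injective _ _ j.injective)).trans_lt x.2⟩
    refine ⟨D.map m, ⟨fun S hS hSD => ?_⟩, fun a ha => ?_⟩
    · have : ⋂ t ∈ S, m ⁻¹' t ∈ (D : Filter _) := (cardinal_bInter_mem hS).2 hSD
      rw [Ultrafilter.mem_coe, Ultrafilter.mem_map, Set.preimage_sInter]
      exact this
    · rw [Ultrafilter.mem_map]
      refine Filter.mem_of_superset (hDf (j ⟨a, ha⟩)) fun x hx => ?_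
      exact ⟨⟨a, ha⟩, hx, rfl⟩
  choose D hDc hDf using hD
  -- Fewer than δ = cof γ points of `s` are bounded in γ; `b y` is a strict bound for those indexed
  -- by `y`.
  have hbd : ∀ y : PKappa δ δ.ord.ToType, ∃ b : γ.ord.ToType, ∀ t : s, e t ∈ y.1 → t.1 < b := by
    intro y
    by_contra! hcon
    have : IsCofinal (Subtype.val '' (e ⁻¹' y.1)) := fun b => by
      obtain ⟨t, ht, hbt⟩ := hcon b
      exact ⟨t, ⟨t, ht, rfl⟩, hbt⟩
    have h1 := Order.cof_le this
    rw [cof_toType, hcof] at h1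
    exact (h1.trans (mk_image_le.trans (mk_preimage_of_injective _ _ e.injective))).not_gt y.2
  choose b hb using hbd
  have hmem : ∀ A : Set (PKappa δ γ.ord.ToType), A ∈ V.bind (fun y => D (b y)) ↔
      {y | A ∈ D (b y)} ∈ V := fun A => Iff.rfl
  refine ⟨hδ, V.bind fun y => D (b y), ⟨fun S hS hSD => ?_⟩, fun a => ?_⟩
  · rw [Ultrafilter.mem_coe, hmem]
    have : ⋂ t ∈ S, {y | t ∈ D (b y)} ∈ (V : Filter _) := (cardinal_bInter_mem hS).2 hSD
    refine Filter.mem_of_superset this fun y hy => ?_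
    exact (hDc (b y)).cardinal_sInter_mem S hS (by simpa using hy)
  · rw [hmem]
    obtain ⟨t, ht, hat⟩ := hs a
    refine Filter.mem_of_superset (hVf (e ⟨t, ht⟩)) fun y hy => ?_
    exact hDf _ _ (hat.trans_lt (hb y ⟨t, ht⟩ hy))

theorem lemma7 (κ : Cardinal.{u}) (hκ : IsSupercompact κ) :
    ∀ β : Ordinal.{u}, β < κ.ord →
      ∃ δ ∈ {δ : Cardinal.{u} | δ < κ ∧
          ∃ γ : Cardinal.{u}, IsLeastSingularStrongLimit δ γ ∧
            IsStronglyCompactUpTo δ γ.ord ∧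
            ¬ IsSupercompactUpTo δ γ.ord ∧
            ∀ α : Ordinal.{u}, α < γ.ord → IsSupercompactUpTo δ α},
        β < δ.ord := by
  intro β hβ
  have hself := hκ κ le_rfl
  obtain ⟨lam, hlam⟩ := exists_isLeastSingularStrongLimit hself.1.le hself.cof_ord
  obtain ⟨δ₀, hδ₀, hgood⟩ := (hκ lam hlam.1.1.le).exists_reflection hlam hβ
  -- Minimality in `S` is what rules out full supercompactness; keeping β < δ in `S` makes the
  -- reflected cardinal compete with the minimum.
  let S : Set Cardinal.{u} := {δ | β < δ.ord ∧ ∃ γ, IsLeastSingularStrongLimit δ γ ∧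
    ∀ α < γ.ord, IsSupercompactUpTo δ α}
  have hleast : IsLeast S (sInf S) := ⟨csInf_mem ⟨δ₀, hgood⟩, fun _ => csInf_le'⟩
  obtain ⟨⟨hβδ, γ, hγ, hSC⟩, hmin⟩ := hleast
  refine ⟨sInf S, ⟨(hmin hgood).trans_lt hδ₀, γ, hγ,
    isStronglyCompactUpTo_of_cof_eq hγ.1.1 hγ.1.2.2.2 hSC, fun hcon => ?_, hSC⟩, hβδ⟩
  obtain ⟨δ', hlt, hδ'⟩ := hcon.exists_reflection hγ hβδ
  exact hlt.not_ge (hmin hδ')
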